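/- Let $x$ be an indeterminate. For an integer $p\ge 0$ write $\binom{\alpha}{p}=\frac{\alpha(\alpha-1)\cdots(\alpha-p+1)}{p!}$ and $(\alpha)_p=\alpha(\alpha+1)\cdots(\alpha+p-1)$, with $(\alpha)_0=1$. Then, for every positive integer $n$, there is a monic polynomial $\mathrm{Pol}_n(x)\in\mathbb{Q}[x]$ of degree $2n-2$ such that $$ \det_{0\le i,j\le n-1}\left(4^i\binom{x+i+2j+3}{2j+3}+\binom{x-i+2j+3}{2j+3}\right) =\left(2\cdot 6^{\binom n2}\prod_{i=0}^{n-1}\frac{i!}{(2i+3)!}\right) \left((x+2)(x+3)\prod_{i=0}^{n-1}(x+3i+1)_{n-i}\right)\mathrm{Pol}_n(x). $$ -/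

import Mathlib

open Polynomial

/-! The `(i, j)` entry is the coefficient of `w ^ (2j+3)` in `(a^i + b^i) (1-w)^(-x-1)`, where `a =
4/(1-w)` and `b = 1-w`. As `ab = 4`, `a^i + b^i` is a polynomial of degree `i` in `s = a + b`, so
row operations leave twice the determinant built from the powers `s^i`. Two further changes of rows
finish the proof. Linear factors: row `d` becomes a monic polynomial in `s` which at `x = -(2i+d+1)`
gives an even series in `w`; its odd coefficients vanish there (`prod_dvd_coeff_rowPolynomial`).
Degree and leading coefficient: `s - 5` is divisible by `w`, so with rows `(s-5)^i` the degree in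
`x` drops by `i`, and the top coefficients form a Vandermonde-type determinant
(`natDegree_symDet_le_and_coeff`). The quotient, made monic, is the required polynomial. -/

section Determinants

/-! ### Row operations, degrees of determinants, a Vandermonde determinant. -/

variable {R : Type*} [CommRing R] {n : ℕ}

/-- Replacing powers of `s` by polynomials in `s` of bounded degree is a triangular change of rows. -/
theorem det_functional_aeval {A : Type*} [CommRing A] [Algebra R A] (L : Fin n → A →ₗ[R] R) (s : A)
    (P : Fin n → R[X]) (hP : ∀ i, (P i).natDegree ≤ i) :
    (Matrix.of fun i j => L j (aeval s (P i))).det =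
      (∏ i, (P i).coeff i) * (Matrix.of fun i j : Fin n => L j (s ^ (i : ℕ))).det := by
  have h : (Matrix.of fun i j => L j (aeval s (P i))) =
      (Matrix.of fun i k : Fin n => (P i).coeff k) *
        (Matrix.of fun i j : Fin n => L j (s ^ (i : ℕ))) := by
    ext i j
    have hi : (P i).natDegree < n := lt_of_le_of_lt (hP i) i.2
    simp only [Matrix.mul_apply, Matrix.of_apply]
    rw [aeval_eq_sum_range' hi, map_sum, Finset.sum_range]
    simp
  rw [h, Matrix.det_mul, Matrix.det_of_isLowerTriangular]
  · rfl
  · intro i j hij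
    have hij' : i < j := hij
    exact coeff_eq_zero_of_natDegree_lt (lt_of_le_of_lt (hP i) hij')

theorem coeff_prod_sum_of_natDegree_le {ι : Type*} (s : Finset ι) (f : ι → R[X]) (c : ι → ℕ)
    (h : ∀ i ∈ s, (f i).natDegree ≤ c i) :
    (∏ i ∈ s, f i).coeff (∑ i ∈ s, c i) = ∏ i ∈ s, (f i).coeff (c i) := by
  classical
  induction s using Finset.induction_on with
  | empty => simp
  | insert a s ha ih =>
    have hs : ∀ i ∈ s, (f i).natDegree ≤ c i := fun i hi => h i (Finset.mem_insert_of_mem hi)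
    rw [Finset.prod_insert ha, Finset.sum_insert ha, Finset.prod_insert ha,
      coeff_mul_add_eq_of_natDegree_le (h a (Finset.mem_insert_self a s))
        ((natDegree_prod_le _ _).trans (Finset.sum_le_sum hs)), ih hs]

/-- A determinant whose columns have bounded degree. -/
theorem natDegree_det_le_of_col (A : Matrix (Fin n) (Fin n) R[X]) (c : Fin n → ℕ)
    (h : ∀ i j, (A i j).natDegree ≤ c j) : A.det.natDegree ≤ ∑ j, c j := by
  rw [Matrix.det_apply]
  refine natDegree_sum_le_of_forall_le _ _ fun σ _ => ?_
  refine (natDegree_smul_le _ _).trans ((natDegree_prod_le _ _).trans ?_)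
  exact Finset.sum_le_sum fun j _ => h _ _

theorem coeff_det_of_col (A : Matrix (Fin n) (Fin n) R[X]) (c : Fin n → ℕ)
    (h : ∀ i j, (A i j).natDegree ≤ c j) :
    A.det.coeff (∑ j, c j) = (Matrix.of fun i j => (A i j).coeff (c j)).det := by
  rw [Matrix.det_apply, Matrix.det_apply, finsetSum_coeff]
  refine Finset.sum_congr rfl fun σ _ => ?_
  rw [coeff_smul, coeff_prod_sum_of_natDegree_le _ _ _ fun j _ => h _ _]
  rfl

/-- A determinant in which the degree of the `(i, j)` entry is at most `c j - i`. -/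
theorem natDegree_det_and_coeff_of_antidiagonal (A : Matrix (Fin n) (Fin n) R[X]) (c : Fin n → ℕ)
    (h : ∀ i j : Fin n, (X ^ (i : ℕ) * A i j).natDegree ≤ c j) (N : ℕ)
    (hN : N + ∑ i : Fin n, (i : ℕ) = ∑ j, c j) :
    A.det.natDegree ≤ N ∧
      A.det.coeff N = (Matrix.of fun i j : Fin n => (X ^ (i : ℕ) * A i j).coeff (c j)).det := by
  -- Scaling row `i` by `X^i` makes the degree bound depend on the column alone and avoids truncated
  -- subtraction.
  have hdet : (Matrix.of fun i j : Fin n => X ^ (i : ℕ) * A i j).det =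
      X ^ (∑ i : Fin n, (i : ℕ)) * A.det := by
    rw [Matrix.det_mul_column (fun i : Fin n => (X : R[X]) ^ (i : ℕ)) A, Finset.prod_pow_eq_pow_sum]
  have h1 := natDegree_det_le_of_col (Matrix.of fun i j : Fin n => X ^ (i : ℕ) * A i j) c h
  have h2 := coeff_det_of_col (Matrix.of fun i j : Fin n => X ^ (i : ℕ) * A i j) c h
  rw [hdet] at h1 h2
  constructor
  · nontriviality R
    rcases eq_or_ne A.det 0 with h0 | h0
    · simp [h0]
    · rw [natDegree_X_pow_mul _ h0] at h1
      omega
  · rw [← hN, coeff_X_pow_mul] at h2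
    exact h2

theorem det_prod_dvd_of_rows (A : Matrix (Fin n) (Fin n) R) (r : Fin n → R)
    (h : ∀ i j, r i ∣ A i j) : (∏ i, r i) ∣ A.det := by
  choose B hB using h
  have : A = Matrix.of fun i j => r i * Matrix.of B i j := by
    ext i j; exact hB i j
  rw [this, Matrix.det_mul_column]
  exact dvd_mul_right _ _

theorem prod_X_sub_C_dvd_of_eval_eq_zero {K ι : Type*} [Field K] (s : Finset ι) (v : ι → K)
    (hv : Function.Injective v) (p : K[X]) (h : ∀ i ∈ s, p.eval (v i) = 0) :
    (∏ i ∈ s, (X - C (v i))) ∣ p :=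
  Finset.prod_dvd_of_coprime (fun _ _ _ _ hij => pairwise_coprime_X_sub_C hv hij)
    fun i hi => dvd_iff_isRoot.2 (h i hi)

theorem det_vandermonde_two_mul_add_three (n : ℕ) :
    (Matrix.vandermonde fun j : Fin n => ((2 * (j : ℕ) + 3 : ℕ) : ℚ)).det =
      2 ^ n.choose 2 * ∏ i ∈ Finset.range n, (i.factorial : ℚ) := by
  have h1 : (Matrix.vandermonde fun j : Fin n => ((2 * (j : ℕ) + 3 : ℕ) : ℚ)).det =
      (Matrix.of fun i j : Fin n => (2 : ℚ) ^ (j : ℕ) *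
        Matrix.vandermonde (fun j : Fin n => ((j : ℕ) : ℚ)) i j).det := by
    push_cast
    rw [Matrix.det_vandermonde_add]
    congr 1
    ext i j
    simp [Matrix.vandermonde_apply, mul_pow]
  rw [h1, Matrix.det_mul_row, Finset.prod_pow_eq_pow_sum]
  congr 1
  · rw [Fin.sum_univ_eq_sum_range (fun i => i), Finset.sum_range_id, Nat.choose_two_right]
  · cases n with
    | zero => simp
    | succ n =>
      rw [Matrix.det_vandermonde_id_eq_superFactorial]
      clear h1
      induction n with
      | zero => simp
      | succ n ih =>
        rw [Finset.prod_range_succ, ← ih, Nat.superFactorial_succ]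
        push_cast
        ring

end Determinants

/-! ### Binomials as coefficients of powers of `1 - w`; the symmetric variable `s`. -/

section BinomialSeries

variable {R : Type*} [CommRing R]

/-- The power series `(1 - w) ^ (-y)`. -/
noncomputable def negBinom [BinomialRing R] (y : R) : PowerSeries R :=
  PowerSeries.mk (Ring.multichoose y)

theorem one_sub_X_mul_negBinom_add_one [BinomialRing R] (y : R) :
    (1 - PowerSeries.X) * negBinom (y + 1) = negBinom y := by
  ext k
  rw [sub_mul, one_mul, map_sub]
  cases k with
  | zero => simp [negBinom]
  | succ k =>
    rw [PowerSeries.coeff_succ_X_mul]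
    simp [negBinom, Ring.multichoose_succ_succ]

theorem mk_one_mul_negBinom [BinomialRing R] (y : R) :
    (PowerSeries.mk 1 : PowerSeries R) * negBinom y = negBinom (y + 1) := by
  rw [← one_sub_X_mul_negBinom_add_one y, ← mul_assoc, PowerSeries.mk_one_mul_one_sub_eq_one,
    one_mul]

theorem negBinom_add_natCast [BinomialRing R] (y : R) (i : ℕ) :
    negBinom (y + i) = (PowerSeries.mk 1 : PowerSeries R) ^ i * negBinom y := by
  induction i with
  | zero => simp
  | succ i ih =>
    rw [pow_succ', mul_assoc, ← ih, mk_one_mul_negBinom]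
    push_cast
    rw [add_assoc]

theorem negBinom_sub_natCast [BinomialRing R] (y : R) (i : ℕ) :
    negBinom (y - i) = (1 - PowerSeries.X) ^ i * negBinom y := by
  induction i with
  | zero => simp
  | succ i ih =>
    rw [pow_succ', mul_assoc, ← ih, ← one_sub_X_mul_negBinom_add_one (y - (i + 1 : ℕ))]
    congr 2
    push_cast
    ring

theorem negBinom_neg_natCast [BinomialRing R] (r : ℕ) :
    negBinom (-(r : R)) = (1 - PowerSeries.X) ^ r := by
  have h0 : negBinom (0 : R) = 1 := by
    ext k
    cases k with
    | zero => simp [negBinom]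
    | succ k => simp [negBinom, PowerSeries.coeff_one]
  rw [← zero_sub, negBinom_sub_natCast, h0, mul_one]

theorem map_negBinom {S : Type*} [CommRing S] [BinomialRing R] [BinomialRing S] (f : R →+* S)
    (y : R) : PowerSeries.map f (negBinom y) = negBinom (f y) := by
  ext k
  simp [negBinom, Ring.map_multichoose]

theorem choose_eq_coeff_negBinom [BinomialRing R] (y : R) (m : ℕ) :
    Ring.choose (y + m) m = PowerSeries.coeff m (negBinom (y + 1)) := by
  rw [negBinom, PowerSeries.coeff_mk, Ring.multichoose_eq]
  congr 1
  ring

/-- The sum `a + b` for `a = 4 / (1 - w)` and `b = 1 - w`, which satisfy `a * b = 4`. -/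
noncomputable def symVar (R : Type*) [CommRing R] : PowerSeries R :=
  4 * PowerSeries.mk 1 + (1 - PowerSeries.X)

theorem map_symVar {S : Type*} [CommRing S] (f : R →+* S) :
    PowerSeries.map f (symVar R) = symVar S := by
  have h : PowerSeries.map f (PowerSeries.mk 1) = PowerSeries.mk 1 := by
    ext k; simp
  have h4 : PowerSeries.map f 4 = 4 := map_ofNat _ 4
  simp [symVar, h, h4]

theorem one_sub_X_mul_symVar :
    (1 - PowerSeries.X) * symVar R = 4 + (1 - PowerSeries.X) ^ 2 := by
  have h := PowerSeries.mk_one_mul_one_sub_eq_one R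
  unfold symVar
  linear_combination 4 * h

/-- The constant term of `s` is 5. The cofactor of `w` has constant term 3, the source of the powers
of 3 in the leading coefficient. -/
theorem symVar_sub_five :
    symVar R - 5 = PowerSeries.X * ((3 + PowerSeries.X) * PowerSeries.mk 1) := by
  have h := PowerSeries.mk_one_mul_one_sub_eq_one R
  unfold symVar
  linear_combination ((PowerSeries.X : PowerSeries R) + 4) * h

/-- Power sums of two elements with product `c` as polynomials in their sum. -/
theorem exists_polynomial_pow_add_pow {A : Type*} [CommRing A] [Algebra R A] (a b : A) (c : R)
    (hab : a * b = algebraMap R A c) (i : ℕ) :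
    ∃ P : R[X], P.natDegree ≤ i ∧ P.coeff i = (if i = 0 then 2 else 1) ∧
      aeval (a + b) P = a ^ i + b ^ i := by
  induction i using Nat.twoStepInduction with
  | zero => exact ⟨C 2, by simp, by simp, by
      rw [aeval_C, map_ofNat, pow_zero, pow_zero, one_add_one_eq_two]⟩
  | one => exact ⟨X, natDegree_X_le, by simp, by simp⟩
  | more i ih0 ih1 =>
    obtain ⟨P, hP, -, hPa⟩ := ih0
    obtain ⟨Q, hQ, hQc, hQa⟩ := ih1
    refine ⟨X * Q - C c * P, ?_, ?_, ?_⟩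
    · have h1 : (X * Q).natDegree ≤ i + 2 := by
        refine natDegree_mul_le.trans ?_
        have := natDegree_X_le (R := R)
        omega
      have h2 : (C c * P).natDegree ≤ i + 2 := (natDegree_C_mul_le c P).trans (hP.trans (by omega))
      exact (natDegree_sub_le_of_le h1 h2).trans (max_self _).le
    · have h1 : (X * Q).coeff (i + 1 + 1) = 1 := by rw [coeff_X_mul, hQc, if_neg (by omega)]
      have h2 : (C c * P).coeff (i + 1 + 1) = 0 := by
        rw [coeff_C_mul, coeff_eq_zero_of_natDegree_lt (by omega), mul_zero]
      rw [coeff_sub, h1, h2, sub_zero, if_neg (by omega)]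
    · rw [map_sub, map_mul, map_mul, aeval_X, aeval_C, hPa, hQa, ← hab]
      ring

theorem coeff_odd_eq_zero_of_rescale_eq [IsAddTorsionFree R] (f : PowerSeries R)
    (hf : PowerSeries.rescale (-1) f = f) {m : ℕ} (hm : Odd m) : PowerSeries.coeff m f = 0 := by
  have h := congrArg (PowerSeries.coeff m) hf
  rw [PowerSeries.coeff_rescale, hm.neg_one_pow, neg_one_mul] at h
  exact self_eq_neg.1 h.symm

/-- The even power series behind the linear relations between the rows. -/
theorem coeff_odd_symVar_eq_zero [IsAddTorsionFree R] (d i m : ℕ) (hid : i ≤ d) (hm : Odd m) :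
    PowerSeries.coeff m ((symVar R - 2) ^ (d - i) * (symVar R - 4) ^ i *
      (1 - PowerSeries.X) ^ (2 * i + d)) = 0 := by
  obtain ⟨e, rfl⟩ := Nat.exists_eq_add_of_le hid
  -- One factor `1-w` makes `s-2` even and three make `s-4` even; the exponent `2i+d = (d-i) + 3i`
  -- supplies exactly these.
  have h2 : (1 - PowerSeries.X) * (symVar R - 2) = 3 + PowerSeries.X ^ 2 := by
    linear_combination one_sub_X_mul_symVar (R := R)
  have h4 : (1 - PowerSeries.X) ^ 3 * (symVar R - 4) = (1 - PowerSeries.X ^ 2) ^ 2 := by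
    linear_combination (1 - PowerSeries.X) ^ 2 * one_sub_X_mul_symVar (R := R)
  have h : (symVar R - 2) ^ (i + e - i) * (symVar R - 4) ^ i *
      (1 - PowerSeries.X) ^ (2 * i + (i + e)) =
      (3 + PowerSeries.X ^ 2) ^ e * ((1 - PowerSeries.X ^ 2) ^ 2) ^ i := by
    rw [← h2, ← h4, mul_pow, mul_pow, ← pow_mul, Nat.add_sub_cancel_left]
    ring
  rw [h]
  refine coeff_odd_eq_zero_of_rescale_eq _ ?_ hm
  have h3 : PowerSeries.rescale (-1 : R) 3 = 3 := map_ofNat _ 3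
  simp [h3]

end BinomialSeries

/-! ### Degrees and top coefficients in `x`. -/

section Degree

theorem factorial_mul_multichoose (k : ℕ) :
    C (k.factorial : ℚ) * Ring.multichoose (X + 1 : ℚ[X]) k = (ascPochhammer ℚ k).comp (X + 1) := by
  have h := Ring.factorial_nsmul_multichoose_eq_ascPochhammer (X + 1 : ℚ[X]) k
  rw [Polynomial.ascPochhammer_smeval_eq_eval, nsmul_eq_mul, ← ascPochhammer_map C, eval_map] at h
  rw [map_natCast]
  exact h

theorem natDegree_multichoose_le (k : ℕ) : (Ring.multichoose (X + 1 : ℚ[X]) k).natDegree ≤ k := by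
  have hk : (k.factorial : ℚ) ≠ 0 := by exact_mod_cast k.factorial_ne_zero
  rw [← natDegree_C_mul hk, factorial_mul_multichoose]
  refine natDegree_comp_le.trans ?_
  rw [ascPochhammer_natDegree, ← C_1, natDegree_X_add_C, mul_one]

theorem coeff_multichoose_self (k : ℕ) :
    (Ring.multichoose (X + 1 : ℚ[X]) k).coeff k = (k.factorial : ℚ)⁻¹ := by
  have hk : (k.factorial : ℚ) ≠ 0 := by exact_mod_cast k.factorial_ne_zero
  have hm : ((ascPochhammer ℚ k).comp (X + C 1)).Monic := (monic_ascPochhammer ℚ k).comp_X_add_C 1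
  have hd : ((ascPochhammer ℚ k).comp (X + C 1)).natDegree = k := by
    rw [natDegree_comp, ascPochhammer_natDegree, natDegree_X_add_C, mul_one]
  have h := congrArg (fun p => coeff p k) (factorial_mul_multichoose k)
  have hc := hm.coeff_natDegree
  rw [hd, C_1] at hc
  simp only [coeff_C_mul, hc] at h
  field_simp
  linarith

/-- Multiplication by a series with constant coefficients. -/
theorem natDegree_coeff_map_C_mul_negBinom (h : PowerSeries ℚ) (k : ℕ) :
    (PowerSeries.coeff k (PowerSeries.map C h * negBinom (X + 1 : ℚ[X]))).natDegree ≤ k ∧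
    (PowerSeries.coeff k (PowerSeries.map C h * negBinom (X + 1 : ℚ[X]))).coeff k =
      PowerSeries.constantCoeff h * (k.factorial : ℚ)⁻¹ := by
  rw [PowerSeries.coeff_mul]
  simp only [negBinom, PowerSeries.coeff_mk, PowerSeries.coeff_map]
  constructor
  · refine natDegree_sum_le_of_forall_le _ _ fun p hp => ?_
    have := Finset.HasAntidiagonal.mem_antidiagonal.1 hp
    exact (natDegree_C_mul_le _ _).trans ((natDegree_multichoose_le _).trans (by omega))
  · rw [finsetSum_coeff, Finset.sum_eq_single (0, k)]
    · rw [coeff_C_mul, coeff_multichoose_self, PowerSeries.coeff_zero_eq_constantCoeff_apply]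
    · intro p hp hne
      have := Finset.HasAntidiagonal.mem_antidiagonal.1 hp
      rw [coeff_C_mul, coeff_eq_zero_of_natDegree_lt, mul_zero]
      refine lt_of_le_of_lt (natDegree_multichoose_le _) ?_
      by_contra hlt
      exact hne (Prod.ext (by simp; omega) (by simp; omega))
    · simp

theorem natDegree_coeff_symVar_sub_five (i m : ℕ) :
    (X ^ i * PowerSeries.coeff m ((symVar ℚ[X] - 5) ^ i * negBinom (X + 1 : ℚ[X]))).natDegree ≤ m ∧
    (X ^ i * PowerSeries.coeff m ((symVar ℚ[X] - 5) ^ i * negBinom (X + 1 : ℚ[X]))).coeff m =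
      3 ^ i * ((m.factorial : ℚ)⁻¹ * (descPochhammer ℚ i).eval (m : ℚ)) := by
  have h : (symVar ℚ[X] - 5) ^ i * negBinom (X + 1 : ℚ[X]) = PowerSeries.X ^ i *
      (PowerSeries.map C (((3 + PowerSeries.X) * PowerSeries.mk 1) ^ i) * negBinom (X + 1)) := by
    have h1 : PowerSeries.map (C : ℚ →+* ℚ[X]) (PowerSeries.mk 1) = PowerSeries.mk 1 := by
      ext k; simp
    have h3 : PowerSeries.map (C : ℚ →+* ℚ[X]) 3 = 3 := map_ofNat _ 3
    rw [symVar_sub_five, mul_pow, map_pow, map_mul, map_add, h1, h3, PowerSeries.map_X, mul_assoc]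
  rw [h, PowerSeries.coeff_X_pow_mul', descPochhammer_eval_eq_descFactorial]
  split_ifs with him
  · obtain ⟨k, rfl⟩ := Nat.exists_eq_add_of_le' him
    rw [Nat.add_sub_cancel, coeff_X_pow_mul]
    have hk := natDegree_coeff_map_C_mul_negBinom (((3 + PowerSeries.X) * PowerSeries.mk 1) ^ i) k
    constructor
    · refine natDegree_mul_le.trans ?_
      rw [natDegree_X_pow]
      omega
    · rw [hk.2]
      have hf := Nat.factorial_mul_descFactorial (Nat.le_add_left i k)
      rw [Nat.add_sub_cancel] at hf
      have hf' : (k.factorial : ℚ) * ((k + i).descFactorial i : ℚ) = ((k + i).factorial : ℚ) := by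
        exact_mod_cast hf
      have h1 : (k.factorial : ℚ) ≠ 0 := by exact_mod_cast k.factorial_ne_zero
      have h2 : ((k + i).factorial : ℚ) ≠ 0 := by exact_mod_cast (k + i).factorial_ne_zero
      have h3 : PowerSeries.constantCoeff (3 : PowerSeries ℚ) = 3 := map_ofNat _ 3
      have h4 : PowerSeries.constantCoeff (PowerSeries.mk 1 : PowerSeries ℚ) = 1 := by
        rw [← PowerSeries.coeff_zero_eq_constantCoeff_apply, PowerSeries.coeff_mk, Pi.one_apply]
      simp only [map_pow, map_mul, map_add, h3, h4, PowerSeries.constantCoeff_X, add_zero, mul_one]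
      field_simp
      linarith
  -- For `i > m` the series is divisible by `w^i`, so both sides vanish.
  · rw [Nat.descFactorial_eq_zero_iff_lt.2 (by omega)]
    simp

end Degree

/-! ### Row reduction to powers of `s`. -/

section Rows

variable {R : Type*} [CommRing R] {n : ℕ}

theorem det_coeff_eval₂_mul (N s : PowerSeries R) (m : Fin n → ℕ) (P : Fin n → R[X])
    (hP : ∀ i, (P i).natDegree ≤ i) :
    (Matrix.of fun i j => PowerSeries.coeff (m j) (eval₂ PowerSeries.C s (P i) * N)).det =
      (∏ i, (P i).coeff i) *
        (Matrix.of fun i j : Fin n => PowerSeries.coeff (m j) (s ^ (i : ℕ) * N)).det :=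
  det_functional_aeval
    (fun j => (PowerSeries.coeff (m j)).comp (LinearMap.mulRight R N)) s P hP

theorem det_coeff_pow_add_pow (N : PowerSeries R) (m : Fin n → ℕ) (hn : 1 ≤ n) :
    (Matrix.of fun i j : Fin n => PowerSeries.coeff (m j)
      (((4 * PowerSeries.mk 1) ^ (i : ℕ) + (1 - PowerSeries.X) ^ (i : ℕ)) * N)).det =
      2 * (Matrix.of fun i j : Fin n =>
        PowerSeries.coeff (m j) (symVar R ^ (i : ℕ) * N)).det := by
  have hab : (4 * PowerSeries.mk 1 : PowerSeries R) * (1 - PowerSeries.X) =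
      algebraMap R (PowerSeries R) 4 := by
    rw [mul_assoc, PowerSeries.mk_one_mul_one_sub_eq_one, mul_one, map_ofNat]
  choose P hP hPc hPe using exists_polynomial_pow_add_pow _ _ (4 : R) hab
  have h := det_coeff_eval₂_mul N (symVar R) m (fun i => P i) fun i => hP i
  have he : ∀ i, eval₂ PowerSeries.C (symVar R) (P i) =
      (4 * PowerSeries.mk 1) ^ i + (1 - PowerSeries.X) ^ i := hPe
  simp only [he, hPc] at h
  rw [h]
  congr 1
  -- Only row 0, where `a^0 + b^0 = 2`, has leading coefficient other than 1; it exists because `n ≥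
  -- 1`.
  obtain ⟨k, rfl⟩ := Nat.exists_eq_add_of_le' hn
  rw [Fin.prod_univ_succ]
  simp

end Rows

/-! ### The linear factors. -/

/-- Row combinations monic of degree `d` in the second variable, interpolating
`(Y - 2) ^ (d - i) * (Y - 4) ^ i` at `X = -(2 i + d + 1)` for `i ≤ d`. -/
noncomputable def rowPolynomial (d : ℕ) : ℚ[X][X] :=
  ∑ i ∈ Finset.range (d + 1),
    C (Lagrange.basis (Finset.range (d + 1)) (fun i : ℕ => -(2 * i + d + 1 : ℚ)) i) *
      ((X - C 2) ^ (d - i) * (X - C 4) ^ i)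

theorem rowPolynomial_nodes_injective (d : ℕ) :
    Function.Injective fun i : ℕ => -(2 * i + d + 1 : ℚ) := by
  intro i j h
  have h' : -(2 * i + d + 1 : ℚ) = -(2 * j + d + 1 : ℚ) := h
  have : (i : ℚ) = j := by linarith
  exact_mod_cast this

theorem monic_rowPolynomial_summand (d i : ℕ) (hi : i ≤ d) :
    ((X - C 2 : ℚ[X][X]) ^ (d - i) * (X - C 4) ^ i).Monic ∧
      ((X - C 2 : ℚ[X][X]) ^ (d - i) * (X - C 4) ^ i).natDegree = d := by
  have h2 := (monic_X_sub_C (2 : ℚ[X])).pow (d - i)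
  have h4 := (monic_X_sub_C (4 : ℚ[X])).pow i
  refine ⟨h2.mul h4, ?_⟩
  rw [h2.natDegree_mul h4, natDegree_pow, natDegree_pow, natDegree_X_sub_C, natDegree_X_sub_C]
  omega

theorem natDegree_rowPolynomial_le (d : ℕ) : (rowPolynomial d).natDegree ≤ d := by
  refine natDegree_sum_le_of_forall_le _ _ fun i hi => (natDegree_C_mul_le _ _).trans ?_
  exact (monic_rowPolynomial_summand d i (by rw [Finset.mem_range] at hi; omega)).2.le

/-- The Lagrange basis sums to 1 and multiplies monic polynomials of equal degree, so this change of
rows preserves the determinant. -/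
theorem coeff_rowPolynomial_self (d : ℕ) : (rowPolynomial d).coeff d = 1 := by
  rw [← Lagrange.sum_basis (s := Finset.range (d + 1))
    (rowPolynomial_nodes_injective d).injOn ⟨0, by simp⟩, rowPolynomial, finsetSum_coeff]
  refine Finset.sum_congr rfl fun i hi => ?_
  obtain ⟨hm, hd⟩ := monic_rowPolynomial_summand d i (by rw [Finset.mem_range] at hi; omega)
  have h := hm.coeff_natDegree
  rw [hd] at h
  rw [coeff_C_mul, h, mul_one]

theorem map_eval₂_rowPolynomial (d i : ℕ) (hi : i ≤ d) :
    PowerSeries.map (evalRingHom (-(2 * i + d + 1 : ℚ)))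
      (eval₂ PowerSeries.C (symVar ℚ[X]) (rowPolynomial d)) =
        (symVar ℚ - 2) ^ (d - i) * (symVar ℚ - 4) ^ i := by
  have hi' : i ∈ Finset.range (d + 1) := Finset.mem_range.2 (by omega)
  rw [rowPolynomial, eval₂_finsetSum, map_sum, Finset.sum_eq_single_of_mem i hi']
  · have h2 : (PowerSeries.map (evalRingHom (-(2 * i + d + 1 : ℚ)))) (PowerSeries.C 2) = 2 := by
      rw [PowerSeries.map_C, map_ofNat, map_ofNat]
    have h4 : (PowerSeries.map (evalRingHom (-(2 * i + d + 1 : ℚ)))) (PowerSeries.C 4) = 4 := by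
      rw [PowerSeries.map_C, map_ofNat, map_ofNat]
    simp only [eval₂_mul, eval₂_pow, eval₂_sub, eval₂_X, eval₂_C, map_mul, map_pow, map_sub,
      map_symVar, PowerSeries.map_C, h2, h4]
    rw [coe_evalRingHom, Lagrange.eval_basis_self (rowPolynomial_nodes_injective d).injOn hi',
      map_one, one_mul]
  · intro j hj hne
    rw [eval₂_mul, eval₂_C, map_mul, PowerSeries.map_C, coe_evalRingHom,
      Lagrange.eval_basis_of_ne (v := fun i : ℕ => -(2 * i + d + 1 : ℚ)) hne hi', map_zero,
      zero_mul]

theorem eval_coeff_mul_negBinom (f : PowerSeries ℚ[X]) (r m : ℕ) :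
    (PowerSeries.coeff m (f * negBinom (X + 1))).eval (-(r + 1 : ℚ)) =
      PowerSeries.coeff m (PowerSeries.map (evalRingHom (-(r + 1 : ℚ))) f *
        (1 - PowerSeries.X) ^ r) := by
  rw [← negBinom_neg_natCast, ← coe_evalRingHom, ← PowerSeries.coeff_map, map_mul, map_negBinom]
  congr 3
  simp

theorem prod_dvd_coeff_rowPolynomial (d j : ℕ) :
    (∏ i ∈ Finset.range (d + 1), (X - C (-(2 * i + d + 1 : ℚ)))) ∣
      PowerSeries.coeff (2 * j + 3)
        (eval₂ PowerSeries.C (symVar ℚ[X]) (rowPolynomial d) * negBinom (X + 1)) := by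
  refine prod_X_sub_C_dvd_of_eval_eq_zero _ _ (rowPolynomial_nodes_injective d) _ fun i hi => ?_
  have hid : i ≤ d := by rw [Finset.mem_range] at hi; omega
  have h := eval_coeff_mul_negBinom
    (eval₂ PowerSeries.C (symVar ℚ[X]) (rowPolynomial d)) (2 * i + d) (2 * j + 3)
  push_cast at h
  rw [h, map_eval₂_rowPolynomial d i hid]
  exact coeff_odd_symVar_eq_zero d i _ hid ⟨j + 1, by ring⟩

theorem rowPolynomial_zero : rowPolynomial 0 = 1 := by
  simp [rowPolynomial]

/-- At `x = -1, -2, -3` row 0 comes from `(1-w)^r` with `r ≤ 2`, of degree below `2j+3`. This yields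
the extra factors `x+2` and `x+3`. -/
theorem prod_dvd_coeff_rowPolynomial_zero (j : ℕ) :
    (∏ i ∈ Finset.range 3, (X - C (-(i + 1 : ℚ)))) ∣
      PowerSeries.coeff (2 * j + 3)
        (eval₂ PowerSeries.C (symVar ℚ[X]) (rowPolynomial 0) * negBinom (X + 1)) := by
  have hinj : Function.Injective fun i : ℕ => -(i + 1 : ℚ) := fun i j h => by
    have h' : -(i + 1 : ℚ) = -(j + 1 : ℚ) := h
    have : (i : ℚ) = j := by linarith
    exact_mod_cast this
  refine prod_X_sub_C_dvd_of_eval_eq_zero _ _ hinj _ fun i hi => ?_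
  rw [eval_coeff_mul_negBinom, rowPolynomial_zero, eval₂_one, map_one, one_mul]
  have hp : ((1 - PowerSeries.X) ^ i : PowerSeries ℚ) = ((1 - X : ℚ[X]) ^ i : ℚ[X]) := by
    simp
  rw [hp, coeff_coe]
  refine coeff_eq_zero_of_natDegree_lt (lt_of_le_of_lt natDegree_pow_le ?_)
  have h1 : (1 - X : ℚ[X]).natDegree ≤ 1 := by compute_degree
  have h2 := Nat.mul_le_mul_left i h1
  rw [Finset.mem_range] at hi
  omega

/-- The product of the linear factors. -/
noncomputable def linearFactors (n : ℕ) : ℚ[X] :=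
  (X + 2) * (X + 3) *
    ∏ i ∈ Finset.range n, (ascPochhammer ℚ[X] (n - i)).eval (X + 3 * (i : ℚ[X]) + 1)

theorem ascPochhammer_eval_eq_prod {S : Type*} [CommSemiring S] (k : ℕ) (y : S) :
    (ascPochhammer S k).eval y = ∏ t ∈ Finset.range k, (y + t) := by
  induction k with
  | zero => simp
  | succ k ih => rw [ascPochhammer_succ_eval, ih, Finset.prod_range_succ]

theorem linearFactors_eq (n : ℕ) :
    linearFactors n = (X - C (-2)) * (X - C (-3)) * ∏ d ∈ Finset.range n,
      ∏ i ∈ Finset.range (d + 1), (X - C (-(2 * i + d + 1 : ℚ))) := by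
  -- The factors `x+3i+t+1` are regrouped by row index `d = i + t`, where `3i+t = 2i+d`.
  have h := Finset.prod_range_diag_flip n fun i t : ℕ => (X - C (-(3 * i + t + 1 : ℚ)))
  have h1 : ∀ d ∈ Finset.range n, ∏ i ∈ Finset.range (d + 1), (X - C (-(2 * i + d + 1 : ℚ))) =
      ∏ i ∈ Finset.range (d + 1), (X - C (-(3 * i + (d - i : ℕ) + 1 : ℚ))) := by
    refine fun d _ => Finset.prod_congr rfl fun i hi => ?_
    have hid : i ≤ d := by rw [Finset.mem_range] at hi; omega
    rw [Nat.cast_sub hid]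
    congr 3
    ring
  rw [Finset.prod_congr rfl h1, h, linearFactors]
  have h2 : (C 2 : ℚ[X]) = 2 := map_ofNat _ 2
  have h3 : (C 3 : ℚ[X]) = 3 := map_ofNat _ 3
  congr 1
  · simp [h2, h3]
  · refine Finset.prod_congr rfl fun i _ => ?_
    rw [ascPochhammer_eval_eq_prod]
    refine Finset.prod_congr rfl fun t _ => ?_
    simp [h3]
    ring

theorem monic_linearFactors (n : ℕ) : (linearFactors n).Monic := by
  rw [linearFactors_eq]
  refine ((monic_X_sub_C _).mul (monic_X_sub_C _)).mul ?_
  exact monic_prod_of_monic _ _ fun d _ => monic_prod_of_monic _ _ fun i _ => monic_X_sub_C _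

theorem natDegree_linearFactors (n : ℕ) :
    (linearFactors n).natDegree = 2 + ∑ d ∈ Finset.range n, (d + 1) := by
  have hd : ∀ d : ℕ,
      (∏ i ∈ Finset.range (d + 1), (X - C (-(2 * i + d + 1 : ℚ)))).Monic := fun d =>
    monic_prod_of_monic _ _ fun i _ => monic_X_sub_C _
  have h2 := (monic_X_sub_C (-2 : ℚ)).mul (monic_X_sub_C (-3 : ℚ))
  rw [linearFactors_eq, h2.natDegree_mul (monic_prod_of_monic _ _ fun d _ => hd d),
    (monic_X_sub_C (-2 : ℚ)).natDegree_mul (monic_X_sub_C (-3 : ℚ)), natDegree_X_sub_C,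
    natDegree_X_sub_C, natDegree_prod_of_monic _ _ fun d _ => hd d]
  congr 1
  refine Finset.sum_congr rfl fun d _ => ?_
  rw [natDegree_prod_of_monic _ _ fun i _ => monic_X_sub_C _]
  simp only [natDegree_X_sub_C, Finset.sum_const, Finset.card_range, smul_eq_mul, mul_one]

/-! ### Divisibility, degree and leading coefficient of the reduced determinant. -/

/-- The reduced determinant. -/
noncomputable def symDet (n : ℕ) : ℚ[X] :=
  (Matrix.of fun i j : Fin n => PowerSeries.coeff (2 * (j : ℕ) + 3)
    (symVar ℚ[X] ^ (i : ℕ) * negBinom (X + 1))).det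

theorem linearFactors_dvd_symDet (n : ℕ) (hn : 1 ≤ n) : linearFactors n ∣ symDet n := by
  have h := det_coeff_eval₂_mul (negBinom (X + 1)) (symVar ℚ[X]) (fun j : Fin n => 2 * (j : ℕ) + 3)
    (fun i => rowPolynomial i) fun i => natDegree_rowPolynomial_le i
  simp only [coeff_rowPolynomial_self, Finset.prod_const_one, one_mul] at h
  rw [symDet, ← h]
  obtain ⟨k, rfl⟩ := Nat.exists_eq_add_of_le' hn
  let r : ℕ → ℚ[X] := fun d => if d = 0 then ∏ i ∈ Finset.range 3, (X - C (-(i + 1 : ℚ)))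
    else ∏ i ∈ Finset.range (d + 1), (X - C (-(2 * i + d + 1 : ℚ)))
  have hr : linearFactors (k + 1) = ∏ i : Fin (k + 1), r i := by
    rw [linearFactors_eq, Fin.prod_univ_eq_prod_range, Finset.prod_range_succ',
      Finset.prod_range_succ' r]
    have h0 : ∀ d ∈ Finset.range k, r (d + 1) =
        ∏ i ∈ Finset.range (d + 1 + 1), (X - C (-(2 * i + (d + 1 : ℕ) + 1 : ℚ))) := fun d _ =>
      if_neg d.succ_ne_zero
    have h1 : r 0 = (X - C (-1)) * ((X - C (-2)) * (X - C (-3))) := by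
      simp only [r, if_pos, Finset.prod_range_succ, Finset.prod_range_zero]
      norm_num
      ring
    rw [Finset.prod_congr rfl h0, h1]
    norm_num
    ring
  rw [hr]
  refine det_prod_dvd_of_rows _ (fun i => r i) fun i j => ?_
  rw [Matrix.of_apply]
  rcases Nat.eq_zero_or_pos (i : ℕ) with hi | hi
  · simp only [r, hi, if_pos]
    exact prod_dvd_coeff_rowPolynomial_zero j
  · simp only [r, if_neg hi.ne']
    exact prod_dvd_coeff_rowPolynomial i j

theorem natDegree_symDet_le_and_coeff (n N : ℕ)
    (hN : N + ∑ i : Fin n, (i : ℕ) = ∑ j : Fin n, (2 * (j : ℕ) + 3)) :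
    (symDet n).natDegree ≤ N ∧ (symDet n).coeff N =
      6 ^ n.choose 2 * ∏ i ∈ Finset.range n, (i.factorial : ℚ) / ((2 * i + 3).factorial : ℚ) := by
  have h := det_coeff_eval₂_mul (negBinom (X + 1)) (symVar ℚ[X]) (fun j : Fin n => 2 * (j : ℕ) + 3)
    (fun i => (X - C 5) ^ (i : ℕ)) fun i => by
      rw [natDegree_pow, natDegree_X_sub_C, mul_one]
  have hc : ∀ i : ℕ, ((X - C 5 : ℚ[X][X]) ^ i).coeff i = 1 := fun i => by
    have := ((monic_X_sub_C (5 : ℚ[X])).pow i).coeff_natDegree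
    rwa [natDegree_pow, natDegree_X_sub_C, mul_one] at this
  have h5 : PowerSeries.C (5 : ℚ[X]) = 5 := map_ofNat _ 5
  simp only [hc, Finset.prod_const_one, one_mul, eval₂_pow, eval₂_sub, eval₂_X, eval₂_C, h5] at h
  rw [symDet, ← h]
  obtain ⟨h1, h2⟩ := natDegree_det_and_coeff_of_antidiagonal _ (fun j : Fin n => 2 * (j : ℕ) + 3)
    (fun i j => (natDegree_coeff_symVar_sub_five i (2 * j + 3)).1) N hN
  refine ⟨h1, h2.trans ?_⟩
  simp only [(natDegree_coeff_symVar_sub_five _ _).2]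
  -- Falling factorials are monic, so at the nodes `2j+3` they have the Vandermonde determinant; its
  -- powers of 2 join the powers of 3 to give powers of 6.
  have hv := Matrix.det_eval_matrixOfPolynomials_eq_det_vandermonde
    (fun j : Fin n => ((2 * (j : ℕ) + 3 : ℕ) : ℚ)) (fun i => descPochhammer ℚ i)
    (fun i => descPochhammer_natDegree ℚ i) (fun i => monic_descPochhammer ℚ i)
  have hd := (Matrix.det_mul_column (fun i : Fin n => (3 : ℚ) ^ (i : ℕ))
    (Matrix.of fun i j : Fin n => (((2 * (j : ℕ) + 3).factorial : ℚ)⁻¹ *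
      (descPochhammer ℚ i).eval ((2 * (j : ℕ) + 3 : ℕ) : ℚ)))).trans (congrArg _
    (Matrix.det_mul_row (fun j : Fin n => ((2 * (j : ℕ) + 3).factorial : ℚ)⁻¹)
      (Matrix.of fun i j : Fin n =>
        (descPochhammer ℚ i).eval ((2 * (j : ℕ) + 3 : ℕ) : ℚ))))
  refine hd.trans ?_
  rw [← Matrix.det_transpose]
  refine (congrArg (fun z => _ * (_ * z)) (hv.symm.trans (det_vandermonde_two_mul_add_three n))).trans
    ?_
  rw [Finset.prod_pow_eq_pow_sum, Fin.sum_univ_eq_sum_range (fun i => i), Finset.sum_range_id,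
    ← Nat.choose_two_right, Fin.prod_univ_eq_prod_range
    (fun j : ℕ => ((2 * j + 3).factorial : ℚ)⁻¹), Finset.prod_div_distrib, Finset.prod_inv_distrib,
    show (6 : ℚ) = 3 * 2 by norm_num, mul_pow]
  ring

/-! ### The original matrix and the conclusion. -/

theorem matrix_entry_eq_coeff (i j : ℕ) :
    4 ^ i * Ring.choose ((X : ℚ[X]) + (i : ℕ) + 2 * (j : ℕ) + 3) (2 * j + 3)
      + Ring.choose ((X : ℚ[X]) - (i : ℕ) + 2 * (j : ℕ) + 3) (2 * j + 3) =
    PowerSeries.coeff (2 * j + 3)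
      (((4 * PowerSeries.mk 1) ^ i + (1 - PowerSeries.X) ^ i) * negBinom (X + 1)) := by
  have h1 : Ring.choose ((X : ℚ[X]) + (i : ℕ) + 2 * (j : ℕ) + 3) (2 * j + 3) =
      PowerSeries.coeff (2 * j + 3) (PowerSeries.mk 1 ^ i * negBinom (X + 1)) := by
    rw [← negBinom_add_natCast, add_right_comm (X : ℚ[X]) 1, ← choose_eq_coeff_negBinom]
    congr 1
    push_cast
    ring
  have h2 : Ring.choose ((X : ℚ[X]) - (i : ℕ) + 2 * (j : ℕ) + 3) (2 * j + 3) =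
      PowerSeries.coeff (2 * j + 3) ((1 - PowerSeries.X) ^ i * negBinom (X + 1)) := by
    rw [← negBinom_sub_natCast, add_sub_right_comm, ← choose_eq_coeff_negBinom]
    congr 1
    push_cast
    ring
  have h4 : (4 : PowerSeries ℚ[X]) ^ i = PowerSeries.C (4 ^ i) := by
    rw [map_pow, map_ofNat]
  rw [h1, h2, add_mul, map_add, mul_pow, mul_assoc, h4, PowerSeries.coeff_C_mul]

theorem theorem7p3 (n : ℕ) (hn : 1 ≤ n) :
    ∃ Pol : ℚ[X], Pol.Monic ∧ Pol.natDegree = 2 * n - 2 ∧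
      (Matrix.of fun i j : Fin n =>
          4 ^ (i : ℕ) * Ring.choose ((X : ℚ[X]) + (i : ℕ) + 2 * (j : ℕ) + 3) (2 * (j : ℕ) + 3)
            + Ring.choose ((X : ℚ[X]) - (i : ℕ) + 2 * (j : ℕ) + 3) (2 * (j : ℕ) + 3)).det
        = C (2 * 6 ^ (n.choose 2)
              * ∏ i ∈ Finset.range n, (i.factorial : ℚ) / ((2 * i + 3).factorial : ℚ))
          * ((X + 2) * (X + 3)
              * ∏ i ∈ Finset.range n, (ascPochhammer ℚ[X] (n - i)).eval (X + 3 * (i : ℚ[X]) + 1))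
          * Pol := by
  simp only [matrix_entry_eq_coeff]
  rw [det_coeff_pow_add_pow _ (fun j : Fin n => 2 * (j : ℕ) + 3) hn]
  change ∃ Pol : ℚ[X], _ ∧ _ ∧ 2 * symDet n = _ * linearFactors n * Pol
  have hm := monic_linearFactors n
  have hsum : (linearFactors n).natDegree + (2 * n - 2) + ∑ i : Fin n, (i : ℕ) =
      ∑ j : Fin n, (2 * (j : ℕ) + 3) := by
    rw [natDegree_linearFactors, Fin.sum_univ_eq_sum_range (fun i => i),
      Fin.sum_univ_eq_sum_range (fun i => 2 * i + 3), Finset.sum_add_distrib,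
      Finset.sum_add_distrib, ← Finset.mul_sum]
    simp only [Finset.sum_const, Finset.card_range, smul_eq_mul]
    omega
  obtain ⟨hdeg, hcoeff⟩ := natDegree_symDet_le_and_coeff n _ hsum
  rw [mul_assoc (2 : ℚ), ← hcoeff]
  -- The coefficient at the degree bound is nonzero, so the bound is attained and the quotient has
  -- degree exactly `2n-2`.
  have hc0 : (symDet n).coeff ((linearFactors n).natDegree + (2 * n - 2)) ≠ 0 := by
    rw [hcoeff]
    refine mul_ne_zero (by positivity) (Finset.prod_ne_zero_iff.2 fun i _ => ?_)
    positivity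
  set c := (symDet n).coeff ((linearFactors n).natDegree + (2 * n - 2))
  have hnat : (symDet n).natDegree = (linearFactors n).natDegree + (2 * n - 2) :=
    le_antisymm hdeg (le_natDegree_of_ne_zero hc0)
  obtain ⟨Q, hQ⟩ := linearFactors_dvd_symDet n hn
  have hQ0 : Q ≠ 0 := by
    rintro rfl
    exact hc0 (by simp [c, hQ])
  have hQdeg : Q.natDegree = 2 * n - 2 := by
    rw [hQ, hm.natDegree_mul' hQ0] at hnat
    omega
  have hQlead : Q.leadingCoeff = c := by
    rw [← leadingCoeff_monic_mul hm, ← hQ, leadingCoeff, hnat]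
  refine ⟨C c⁻¹ * Q, ?_, ?_, ?_⟩
  · rw [Monic, leadingCoeff_mul, leadingCoeff_C, hQlead, inv_mul_cancel₀ hc0]
  · rw [natDegree_C_mul (inv_ne_zero hc0), hQdeg]
  · have hcc : C c * C c⁻¹ = (1 : ℚ[X]) := by rw [← C_mul, mul_inv_cancel₀ hc0, C_1]
    have h2 : (C 2 : ℚ[X]) = 2 := map_ofNat _ 2
    rw [C_mul, h2, hQ]
    linear_combination (-2 * linearFactors n * Q) * hcc
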